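/- Let $K'\subset\mathbb R^d$ be convex and compact, and let $q:U\to q(U)$ be a $C^3$-diffeomorphism between open subsets of $\mathbb R^d$, with $K'\subset U$, whose Jacobian matrix $J_q(u)$ is diagonal for every $u\in U$. Assume that $K:=q(K')$ is convex and compact. Then there is a function $R:\mathbb R^d\to\mathbb R$ such that: 1. $R$ is $C^3$ on a neighbourhood of $K$, strongly convex on $K$ (for the Euclidean norm, with some constant $m>0$), and its Bregman divergence $D_R(x\|y)=R(x)-R(y)-\nabla R(y)^\top(x-y)$ is bounded above on $K\times K$; 2. $q$ maps $K'$ bijectively onto $K$ and $[\nabla^2R(q(u))]^{-1}=J_q(u)J_q(u)^\top$ for all $u\in K'$; 3. $R(x)=\sum_{i=1}^d R_i(x_i)$ is separable, on a neighbourhood of $K'$ one has $q(u)=(q_1(u_1),\dots,q_d(u_d))$, and for each $i$ the functions $q_i$ and $R_i$ are $C^3$ near every point $s$ of $\{u_i:u\in K'\}$, respectively near $q_i(s)$, and $\tilde R_i:=R_i\circ q_i$ solves the scalar linear equation $q_i'\tilde R_i''-q_i''\tilde R_i'-q_i'=0$ on $\{u_i:u\in K'\}$; 4. for all $G_F\ge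 0$ and $c>0$ there is a constant $C$ (depending only on $K'$, $q$, $G_F$, $c$) such that the following holds for every $T\ge1$. Let $\tilde f_1,\dots,\tilde f_T:\mathbb R^d\to\mathbb R$ be losses, not necessarily convex, that are differentiable at every $u\in K'$ with $\|\nabla\tilde f_t(u)\|_2\le G_F$ there, and that satisfy $\tilde f_t(u)=f_t(q(u))$ on $K'$ for functions $f_t$ that are convex on $K$. Then $K$, $R$ and $f_1,\dots,f_T$ form an online mirror descent problem: $K$ is convex and compact, each $f_t$ is convex and differentiable on $K$ (relative to $K$), and $R$ is a regularizer as in 1. Moreover online gradient descent with step size $\eta=c\,T^{-2/3}$, that is, $u_1\in K'$ arbitrary and $u_{t+1}=\Pi_{K'}\bigl(u_t-\eta\nabla\tilde f_t(u_t)\bigr)$ with the Euclidean projection $\Pi_{K'}$, satisfies $$\sum_{t=1}^T\tilde f_t(u_t)-\min_{u\in K'}\sum_{t=1}^T\tilde f_t(u)\le C\,T^{2/3}.$$ -/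

import Mathlib

noncomputable section

/-- `ℝ^d` with the Euclidean norm. -/
abbrev Vec (d : ℕ) : Type := EuclideanSpace ℝ (Fin d)

/-- The Jacobian matrix of `q` at `u`, with entries `∂ q_i / ∂ u_j`. -/
def jacobianMatrix {d : ℕ} (q : Vec d → Vec d) (u : Vec d) : Matrix (Fin d) (Fin d) ℝ :=
  Matrix.of fun i j => fderiv ℝ q u (EuclideanSpace.single j 1) i

/-- The Hessian matrix of `R` at `x`. -/
def hessianMatrix {d : ℕ} (R : Vec d → ℝ) (x : Vec d) : Matrix (Fin d) (Fin d) ℝ :=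
  Matrix.of fun i j =>
    fderiv ℝ (fderiv ℝ R) x (EuclideanSpace.single i 1) (EuclideanSpace.single j 1)

/-- The Bregman divergence `D_R(x ‖ y)`. -/
def bregmanDiv {d : ℕ} (R : Vec d → ℝ) (x y : Vec d) : ℝ :=
  R x - R y - inner ℝ (gradient R y) (x - y)

/-- `R` is a regularizer on `K`: it is `C³` on a neighbourhood of `K`, strongly convex on `K`
with respect to the Euclidean norm, and `K` has bounded diameter for its Bregman divergence. -/
structure IsRegularizer {d : ℕ} (K : Set (Vec d)) (R : Vec d → ℝ) : Prop where
  smooth : ∃ V : Set (Vec d), IsOpen V ∧ K ⊆ V ∧ ContDiffOn ℝ 3 R V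
  strongConvex : ∃ m : ℝ, 0 < m ∧ StrongConvexOn K m R
  bounded : ∃ D : ℝ, ∀ x ∈ K, ∀ y ∈ K, bregmanDiv R x y ≤ D

/-- The domain `K`, the losses `f 1, …, f T` and `R` form an online mirror descent problem:
convex domain, losses that are convex and differentiable on it, and a regularizer. -/
structure IsOMDObject {d : ℕ} (K : Set (Vec d)) (R : Vec d → ℝ) (T : ℕ)
    (f : ℕ → Vec d → ℝ) : Prop where
  convex_domain : Convex ℝ K
  compact_domain : IsCompact K
  convex_loss : ∀ t ∈ Finset.Icc 1 T, ConvexOn ℝ K (f t)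
  differentiable_loss : ∀ t ∈ Finset.Icc 1 T, DifferentiableOn ℝ (f t) K
  regularizer : IsRegularizer K R

/-- `q` maps `K'` bijectively onto `K`, and `[∇²R(x)]⁻¹ = J_q(u) J_q(u)ᵀ` at `x = q(u)`. -/
def HessianJacobianRelation {d : ℕ} (q : Vec d → Vec d) (K' K : Set (Vec d))
    (R : Vec d → ℝ) : Prop :=
  Set.BijOn q K' K ∧
    ∀ u ∈ K', (hessianMatrix R (q u))⁻¹ = jacobianMatrix q u * (jacobianMatrix q u).transpose

/-- `R` is separable, `R(x) = ∑ i, ρ_i(x_i)`, near `K'` the map `q` acts coordinatewise,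
`q(u)_i = κ_i(u_i)`, and each `ρ̃_i = ρ_i ∘ κ_i` solves the linear scalar equation
`κ_i' ρ̃_i'' - κ_i'' ρ̃_i' - κ_i' = 0` on the projection of `K'` to the `i`-th axis. -/
def SolvesCoordinateODEs {d : ℕ} (q : Vec d → Vec d) (K' : Set (Vec d))
    (R : Vec d → ℝ) : Prop :=
  ∃ κ ρ : Fin d → ℝ → ℝ,
    (∃ N : Set (Vec d), IsOpen N ∧ K' ⊆ N ∧ ∀ u ∈ N, ∀ i, q u i = κ i (u i)) ∧
    (∀ x, R x = ∑ i, ρ i (x i)) ∧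
    ∀ i, ∀ s ∈ (fun u : Vec d => u i) '' K',
      ContDiffAt ℝ 3 (κ i) s ∧ ContDiffAt ℝ 3 (ρ i) (κ i s) ∧
      deriv (κ i) s * deriv (deriv (ρ i ∘ κ i)) s
        - deriv (deriv (κ i)) s * deriv (ρ i ∘ κ i) s - deriv (κ i) s = 0

/-- The loss `g` is `f ∘ q` on `K'` with `f` convex on `q(K')`, and `g` is differentiable with
gradient bounded by `GF` on `K'`. -/
structure IsReparametrizedLoss {d : ℕ} (q : Vec d → Vec d) (K' : Set (Vec d)) (GF : ℝ)
    (g f : Vec d → ℝ) : Prop where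
  convex : ConvexOn ℝ (q '' K') f
  comp_eq : ∀ u ∈ K', g u = f (q u)
  differentiable : ∀ u ∈ K', DifferentiableAt ℝ g u
  gradient_le : ∀ u ∈ K', ‖gradient g u‖ ≤ GF

/-- `p` is the Euclidean projection of `v` to `K`. -/
def IsEuclideanProjection {d : ℕ} (K : Set (Vec d)) (v p : Vec d) : Prop :=
  p ∈ K ∧ ∀ z ∈ K, ‖v - p‖ ≤ ‖v - z‖

/-- `u 1, …, u (T + 1)` are iterates of projected online gradient descent on the losses
`g 1, …, g T` with step size `η`, started at an arbitrary point of `K`. -/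
def IsOGDRun {d : ℕ} (K : Set (Vec d)) (η : ℝ) (T : ℕ) (g : ℕ → Vec d → ℝ)
    (u : ℕ → Vec d) : Prop :=
  u 1 ∈ K ∧ ∀ t ∈ Finset.Icc 1 T,
    IsEuclideanProjection K (u t - η • gradient (g t) (u t)) (u (t + 1))

/-- The regret of the plays `u 1, …, u T` against the best fixed point of `K`. -/
def regret {d : ℕ} (K : Set (Vec d)) (T : ℕ) (g : ℕ → Vec d → ℝ) (u : ℕ → Vec d) : ℝ :=
  (∑ t ∈ Finset.Icc 1 T, g t (u t)) - sInf ((fun v => ∑ t ∈ Finset.Icc 1 T, g t v) '' K)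

end

/-!
The relation `[∇²R]⁻¹ = J Jᵀ` says that `q` carries the Euclidean metric to the Hessian metric of
`R`. Hence `u ↦ D_R(q v ‖ q u)` has Euclidean gradient `-w u`, where `w u = Dq(u)⁻¹ (q v - q u)`.
This vector is tangent to `K'` because `q(K')` is convex, and convexity of `f` on `q(K')` gives
`⟪∇g u, w u⟫ ≤ g v - g u` for `g = f ∘ q`. So the Bregman divergence serves as a potential for
Euclidean projected gradient descent: one step with step size `η` changes it by at most
`η (g v - g u) + O(η²)`. Summing over `T` steps bounds the regret by `O(1 / η + η T)`, which is
`O(T^{2/3})` for `η = c T^{-2/3}`.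

A suitable `R` exists because a diagonal Jacobian makes `q` act coordinatewise on a convex
neighbourhood of `K'`, so that `R` may be taken as a sum of double primitives of the squared
derivatives of the coordinate maps of `q⁻¹`.
-/

open Set Filter Topology
open scoped NNReal Matrix

section NormedSpace

variable {E F : Type*} [NormedAddCommGroup E] [NormedSpace ℝ E] [NormedAddCommGroup F]
  [NormedSpace ℝ F]

theorem mapsTo_posTangentConeAt_of_hasFDerivWithinAt {f : E → F} {f' : E →L[ℝ] F} {s : Set E}
    {x : E} (h : HasFDerivWithinAt f f' s x) :
    MapsTo f' (posTangentConeAt s x) (posTangentConeAt (f '' s) (f x)) := by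
  intro y hy
  obtain ⟨ι, l, hl, c, d, hd₀, hds, hcd⟩ := exists_fun_of_mem_tangentConeAt hy
  refine mem_tangentConeAt_of_seq l c (fun n => f (x + d n) - f x) ?_
    (hds.mono fun n hn => ⟨x + d n, hn, by simp⟩) (h.lim hd₀ hds hcd)
  rw [tendsto_sub_nhds_zero_iff]
  refine h.continuousWithinAt.tendsto.comp (tendsto_nhdsWithin_iff.2 ⟨?_, hds⟩)
  simpa using tendsto_const_nhds.add hd₀

theorem apply_sub_le_sub_of_convexOn {K : Set E} {f : E → ℝ} {f' : E →L[ℝ] ℝ} {x y : E}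
    (hf : ConvexOn ℝ K f) (hf' : HasFDerivWithinAt f f' K x) (hx : x ∈ K) (hy : y ∈ K) :
    f' (y - x) ≤ f y - f x := by
  have hmaps : MapsTo (AffineMap.lineMap (k := ℝ) x y) (Icc 0 1) K := hf.1.mapsTo_lineMap hx hy
  have hconv : ConvexOn ℝ (Icc (0 : ℝ) 1) (f ∘ AffineMap.lineMap x y) :=
    (hf.comp_affineMap _).subset hmaps (convex_Icc 0 1)
  have hderiv : HasDerivWithinAt (f ∘ AffineMap.lineMap x y) (f' (y - x)) (Icc (0 : ℝ) 1) 0 := by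
    refine HasFDerivWithinAt.comp_hasDerivWithinAt (t := K) 0 ?_
      AffineMap.hasDerivWithinAt_lineMap hmaps
    rwa [AffineMap.lineMap_apply_zero]
  simpa [slope_def_field] using hconv.le_slope_of_hasDerivWithinAt (left_mem_Icc.2 zero_le_one)
    (right_mem_Icc.2 zero_le_one) one_pos hderiv

end NormedSpace

section ProjectedStep

variable {E : Type*} [NormedAddCommGroup E] [InnerProductSpace ℝ E] {K : Set E}

theorem inner_nonneg_of_mem_posTangentConeAt {x p w : E} (hmin : ∀ z ∈ K, ‖x - p‖ ≤ ‖x - z‖)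
    (hw : w ∈ posTangentConeAt K p) : 0 ≤ inner ℝ (p - x) w := by
  have hloc : IsMinOn (fun z => ‖z - x‖ ^ 2) K p := fun z hz => by
    have := hmin z hz
    rw [norm_sub_rev x p, norm_sub_rev x z] at this
    exact pow_le_pow_left₀ (norm_nonneg _) this 2
  have hderiv := ((hasFDerivAt_id p).sub_const x).norm_sq.hasFDerivWithinAt (s := K)
  simpa [inner_sub_left] using hloc.localize.hasFDerivWithinAt_nonneg hderiv hw

theorem norm_sub_le_of_projected_step {u p γ : E} {G η : ℝ} (hη : 0 ≤ η) (hγ : ‖γ‖ ≤ G)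
    (hu : u ∈ K) (hproj : ∀ z ∈ K, ‖u - η • γ - p‖ ≤ ‖u - η • γ - z‖) :
    ‖p - (u - η • γ)‖ ≤ η * G := by
  calc ‖p - (u - η • γ)‖ = ‖u - η • γ - p‖ := norm_sub_rev _ _
    _ ≤ ‖u - η • γ - u‖ := hproj u hu
    _ = η * ‖γ‖ := by rw [sub_sub_cancel_left, norm_neg, norm_smul, Real.norm_of_nonneg hη]
    _ ≤ η * G := by gcongr

theorem norm_sub_le_mul_of_mem_segment {w : E → E} {L : ℝ≥0} (hw : LipschitzOnWith L w K)
    (hK : Convex ℝ K) {u p z : E} (hu : u ∈ K) (hp : p ∈ K) (hz : z ∈ segment ℝ u p) :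
    ‖w z - w u‖ ≤ L * ‖p - u‖ :=
  (hw.norm_sub_le (hK.segment_subset hu hp hz) hu).trans
    (mul_le_mul_of_nonneg_left (norm_sub_le_of_mem_segment hz) L.2)

theorem potential_sub_le_of_projected_step {w : E → E} {Φ : E → ℝ} {L : ℝ≥0} {G η : ℝ}
    (hK : Convex ℝ K) (hΦ : ∀ u ∈ K, HasFDerivWithinAt Φ (-innerSL ℝ (w u)) K u)
    (hw : LipschitzOnWith L w K) (hη : 0 ≤ η) {u p γ : E} (hu : u ∈ K) (hp : p ∈ K)
    (htan : w p ∈ posTangentConeAt K p) (hγ : ‖γ‖ ≤ G)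
    (hproj : ∀ z ∈ K, ‖u - η • γ - p‖ ≤ ‖u - η • γ - z‖) :
    Φ p - Φ u ≤ η * inner ℝ γ (w u) + 4 * L * (η * G) ^ 2 := by
  obtain ⟨z, hz, hmvt⟩ := domain_mvt hΦ hK hu hp
  set δ : E := p - (u - η • γ) with hδ
  have hδ_norm : ‖δ‖ ≤ η * G := norm_sub_le_of_projected_step hη hγ hu hproj
  have hηG : 0 ≤ η * G := (norm_nonneg _).trans hδ_norm
  have hηγ_norm : ‖η • γ‖ ≤ η * G := by
    rw [norm_smul, Real.norm_of_nonneg hη]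
    gcongr
  have hstep : p - u = δ - η • γ := by rw [hδ]; abel
  have hstep_norm : ‖p - u‖ ≤ 2 * (η * G) := by
    rw [hstep]
    linarith [norm_sub_le δ (η • γ)]
  have hwp : ‖w p - w z‖ ≤ L * (2 * (η * G)) := by
    rw [norm_sub_rev]
    refine (norm_sub_le_mul_of_mem_segment hw hK hp hu (segment_symm ℝ u p ▸ hz)).trans ?_
    rw [norm_sub_rev]
    gcongr
  have hwu : ‖w z - w u‖ ≤ L * (2 * (η * G)) :=
    (norm_sub_le_mul_of_mem_segment hw hK hu hp hz).trans (by gcongr)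
  have hδ_inner : inner ℝ δ (w p - w z) ≤ (η * G) * (L * (2 * (η * G))) :=
    (real_inner_le_norm _ _).trans (by gcongr)
  have hγ_inner : inner ℝ (η • γ) (w z - w u) ≤ (η * G) * (L * (2 * (η * G))) :=
    (real_inner_le_norm _ _).trans (by gcongr)
  have hnormal : 0 ≤ inner ℝ δ (w p) := inner_nonneg_of_mem_posTangentConeAt hproj htan
  have hsplit : Φ p - Φ u = η * inner ℝ γ (w u) + inner ℝ δ (w p - w z)
      + inner ℝ (η • γ) (w z - w u) - inner ℝ δ (w p) := by
    rw [hmvt, hstep, neg_apply, innerSL_apply_apply, inner_sub_right, real_inner_comm δ,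
      real_inner_comm (η • γ)]
    simp only [inner_sub_right, real_inner_smul_left]
    ring
  linarith

end ProjectedStep

section Bregman

variable {d : ℕ} {K : Set (Vec d)} {R : Vec d → ℝ}

theorem bregmanDiv_eq_sub_fderiv (R : Vec d → ℝ) (x y : Vec d) :
    bregmanDiv R x y = R x - R y - fderiv ℝ R y (x - y) := by
  rw [bregmanDiv, inner_gradient_left]

theorem bregmanDiv_nonneg_of_convexOn (hR : ConvexOn ℝ K R) {x y : Vec d} (hx : x ∈ K) (hy : y ∈ K)
    (hRy : DifferentiableAt ℝ R y) : 0 ≤ bregmanDiv R x y := by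
  rw [bregmanDiv_eq_sub_fderiv, sub_nonneg]
  exact apply_sub_le_sub_of_convexOn hR hRy.hasFDerivAt.hasFDerivWithinAt hy hx

theorem exists_bregmanDiv_le {V : Set (Vec d)} (hV : IsOpen V) (hR : ContDiffOn ℝ 1 R V)
    (hK : IsCompact K) (hKV : K ⊆ V) : ∃ D : ℝ, ∀ x ∈ K, ∀ y ∈ K, bregmanDiv R x y ≤ D := by
  have hRc : ContinuousOn R K := hR.continuousOn.mono hKV
  have hR'c : ContinuousOn (fderiv ℝ R) K := (hR.continuousOn_fderiv_of_isOpen hV le_rfl).mono hKV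
  have hcont : ContinuousOn (fun z : Vec d × Vec d => bregmanDiv R z.1 z.2) (K ×ˢ K) := by
    simp only [bregmanDiv_eq_sub_fderiv]
    have hfst : MapsTo Prod.fst (K ×ˢ K) K := fun z hz => hz.1
    have hsnd : MapsTo Prod.snd (K ×ˢ K) K := fun z hz => hz.2
    fun_prop (disch := assumption)
  obtain ⟨D, hD⟩ := (hK.prod hK).bddAbove_image hcont
  exact ⟨D, fun x hx y hy => hD (mem_image_of_mem _ (mk_mem_prod hx hy))⟩

theorem hasFDerivAt_bregmanDiv {y : Vec d} (hR : ContDiffAt ℝ 2 R y) (x : Vec d) :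
    HasFDerivAt (bregmanDiv R x) (-(fderiv ℝ (fderiv ℝ R) y).flip (x - y)) y := by
  have hR₁ : HasFDerivAt R (fderiv ℝ R y) y := (hR.differentiableAt two_ne_zero).hasFDerivAt
  have hR₂ : HasFDerivAt (fderiv ℝ R) (fderiv ℝ (fderiv ℝ R) y) y :=
    ((hR.fderiv_right (m := 1) one_add_one_eq_two.le).differentiableAt one_ne_zero).hasFDerivAt
  have h := (hR₁.const_sub (R x)).sub (hR₂.clm_apply ((hasFDerivAt_id y).const_sub x))
  rw [funext (bregmanDiv_eq_sub_fderiv R x)]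
  refine h.congr_fderiv ?_
  ext v
  simp

end Bregman

section LocalInverse

variable {E F : Type*} [NormedAddCommGroup E] [NormedSpace ℝ E] [NormedAddCommGroup F]
  [NormedSpace ℝ F] {q : OpenPartialHomeomorph E F} {u : E}

theorem fderiv_symm_comp_fderiv (hu : u ∈ q.source) (hq : DifferentiableAt ℝ q u)
    (hq_symm : DifferentiableAt ℝ q.symm (q u)) :
    fderiv ℝ q.symm (q u) ∘L fderiv ℝ q u = .id ℝ E := by
  have hcomp : q.symm ∘ q =ᶠ[𝓝 u] id := q.eventually_left_inverse hu
  rw [← fderiv_comp u hq_symm hq, hcomp.fderiv_eq, fderiv_id]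

theorem fderiv_comp_fderiv_symm (hu : u ∈ q.source) (hq : DifferentiableAt ℝ q u)
    (hq_symm : DifferentiableAt ℝ q.symm (q u)) :
    fderiv ℝ q u ∘L fderiv ℝ q.symm (q u) = .id ℝ F := by
  have h := fderiv_symm_comp_fderiv (q := q.symm) (q.map_source hu) hq_symm
  rw [q.symm_symm, q.left_inv hu] at h
  exact h hq

end LocalInverse

section Matrices

variable {d : ℕ}

theorem ofLp_fderiv_apply (q : Vec d → Vec d) (u v : Vec d) :
    (fderiv ℝ q u v).ofLp = jacobianMatrix q u *ᵥ v.ofLp := by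
  ext i
  conv_lhs => rw [← (EuclideanSpace.basisFun (Fin d) ℝ).sum_repr v]
  simp [jacobianMatrix, Matrix.mulVec, dotProduct, mul_comm]

theorem fderiv_fderiv_apply_eq_dotProduct (R : Vec d → ℝ) (x a b : Vec d) :
    fderiv ℝ (fderiv ℝ R) x a b = a.ofLp ⬝ᵥ hessianMatrix R x *ᵥ b.ofLp := by
  conv_lhs => rw [← (EuclideanSpace.basisFun (Fin d) ℝ).sum_repr a,
    ← (EuclideanSpace.basisFun (Fin d) ℝ).sum_repr b]
  simp only [hessianMatrix, Matrix.mulVec, dotProduct, map_sum, map_smul, sum_apply, smul_apply,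
    Finset.mul_sum, Matrix.of_apply, EuclideanSpace.basisFun_apply, EuclideanSpace.basisFun_repr,
    smul_eq_mul]
  rw [Finset.sum_comm]
  exact Finset.sum_congr rfl fun i _ => Finset.sum_congr rfl fun j _ => by ring

theorem jacobianMatrix_symm_mul {q : OpenPartialHomeomorph (Vec d) (Vec d)} {u : Vec d}
    (hu : u ∈ q.source) (hq : DifferentiableAt ℝ q u)
    (hq_symm : DifferentiableAt ℝ q.symm (q u)) :
    jacobianMatrix q.symm (q u) * jacobianMatrix q u = 1 := by
  refine Matrix.ext_of_mulVec_single fun i => ?_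
  have hcomp := DFunLike.congr_fun (fderiv_symm_comp_fderiv hu hq hq_symm)
    (EuclideanSpace.single i 1)
  rw [← Matrix.mulVec_mulVec, Matrix.one_mulVec, ← PiLp.ofLp_single,
    ← ofLp_fderiv_apply, ← ofLp_fderiv_apply]
  exact congrArg WithLp.ofLp hcomp

theorem HessianJacobianRelation.fderiv_fderiv_eq_inner {q : Vec d → Vec d} {K' K : Set (Vec d)}
    {R : Vec d → ℝ} (h : HessianJacobianRelation q K' K R) {u : Vec d} (hu : u ∈ K')
    (hJ : IsUnit (jacobianMatrix q u)) (a b : Vec d) :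
    fderiv ℝ (fderiv ℝ R) (q u) (fderiv ℝ q u a) (fderiv ℝ q u b) = inner ℝ a b := by
  set J := jacobianMatrix q u
  set H := hessianMatrix R (q u)
  have hJdet : IsUnit J.det := J.isUnit_iff_isUnit_det.1 hJ
  have hinv : H⁻¹ = J * Jᵀ := h.2 u hu
  have hHdet : IsUnit H.det := by
    rw [← Matrix.isUnit_nonsing_inv_det_iff, hinv, Matrix.det_mul, Matrix.det_transpose]
    exact hJdet.mul hJdet
  have hcongr : Jᵀ * H * J = 1 := by
    rw [← Matrix.nonsing_inv_nonsing_inv H hHdet, hinv, Matrix.mul_inv_rev, ← Matrix.mul_assoc,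
      Matrix.mul_nonsing_inv _ (by rwa [Matrix.det_transpose]), Matrix.one_mul,
      Matrix.nonsing_inv_mul _ hJdet]
  calc fderiv ℝ (fderiv ℝ R) (q u) (fderiv ℝ q u a) (fderiv ℝ q u b)
      = (J *ᵥ a.ofLp) ⬝ᵥ H *ᵥ J *ᵥ b.ofLp := by
        rw [fderiv_fderiv_apply_eq_dotProduct, ofLp_fderiv_apply, ofLp_fderiv_apply]
    _ = a.ofLp ⬝ᵥ (Jᵀ * H * J) *ᵥ b.ofLp := by
        rw [← Matrix.vecMul_transpose, ← Matrix.dotProduct_mulVec, Matrix.mulVec_mulVec,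
          Matrix.mulVec_mulVec, Matrix.mul_assoc]
    _ = inner ℝ a b := by
        rw [hcongr, Matrix.one_mulVec, EuclideanSpace.inner_eq_star_dotProduct, star_trivial,
          dotProduct_comm]

end Matrices

section PullbackDirection

variable {E F : Type*} [NormedAddCommGroup E] [NormedSpace ℝ E] [NormedAddCommGroup F]
  [NormedSpace ℝ F] {q : OpenPartialHomeomorph E F} {K' : Set E} {u v : E}

/-- The velocity at `u` of the curve that `q` maps to the straight segment from `q u` to `q v`.
In the coordinates of `q` it plays the role of the displacement `x - y` in `D_R(x ‖ y)`. -/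
noncomputable def pullbackDirection (q : OpenPartialHomeomorph E F) (v u : E) : E :=
  fderiv ℝ q.symm (q u) (q v - q u)

theorem pullbackDirection_mem_posTangentConeAt (hK' : K' ⊆ q.source) (hK : Convex ℝ (q '' K'))
    (hq_symm : DifferentiableAt ℝ q.symm (q u)) (hu : u ∈ K') (hv : v ∈ K') :
    pullbackDirection q v u ∈ posTangentConeAt K' u := by
  have hseg : segment ℝ (q u) (q v) ⊆ q '' K' :=
    hK.segment_subset (mem_image_of_mem q hu) (mem_image_of_mem q hv)
  have h := mapsTo_posTangentConeAt_of_hasFDerivWithinAt hq_symm.hasFDerivAt.hasFDerivWithinAt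
    (sub_mem_posTangentConeAt_of_segment_subset hseg)
  rwa [(q.leftInvOn.mono hK').image_image, q.left_inv (hK' hu)] at h

theorem fderiv_pullbackDirection (hu : u ∈ q.source) (hq : DifferentiableAt ℝ q u)
    (hq_symm : DifferentiableAt ℝ q.symm (q u)) (v : E) :
    fderiv ℝ q u (pullbackDirection q v u) = q v - q u :=
  DFunLike.congr_fun (fderiv_comp_fderiv_symm hu hq hq_symm) (q v - q u)

theorem exists_lipschitzOnWith_pullbackDirection (hK'_convex : Convex ℝ K')
    (hK'_compact : IsCompact K') (hK' : K' ⊆ q.source) (hq : ContDiffOn ℝ 1 q q.source)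
    (hq_symm : ContDiffOn ℝ 2 q.symm q.target) :
    ∃ L : ℝ≥0, ∀ v ∈ K', LipschitzOnWith L (pullbackDirection q v) K' := by
  have hqK : ContDiffOn ℝ 1 q K' := hq.mono hK'
  have hq_symm' : ContDiffOn ℝ 1 (fun u => fderiv ℝ q.symm (q u)) K' :=
    (hq_symm.fderiv_of_isOpen q.open_target one_add_one_eq_two.le).comp hqK
      fun u hu => q.map_source (hK' hu)
  have hjoint : ContDiffOn ℝ 1 (fun z : E × E => pullbackDirection q z.1 z.2) (K' ×ˢ K') :=
    (hq_symm'.comp contDiffOn_snd fun z hz => hz.2).clm_apply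
      ((hqK.comp contDiffOn_fst fun z hz => hz.1).sub (hqK.comp contDiffOn_snd fun z hz => hz.2))
  obtain ⟨L, hL⟩ := hjoint.exists_lipschitzOnWith one_ne_zero (hK'_convex.prod hK'_convex)
    (hK'_compact.prod hK'_compact)
  refine ⟨L, fun v hv => ?_⟩
  rw [← mul_one L]
  exact hL.comp (LipschitzWith.prodMk_left v).lipschitzOnWith fun u hu => mk_mem_prod hv hu

end PullbackDirection

section MirrorDescent

variable {d : ℕ} {q : OpenPartialHomeomorph (Vec d) (Vec d)} {K' : Set (Vec d)}
  {R : Vec d → ℝ} {u : Vec d}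

theorem hasFDerivAt_bregmanDiv_comp {K : Set (Vec d)} (hR : HessianJacobianRelation q K' K R)
    (hK' : K' ⊆ q.source) (hR_contDiff : ContDiffAt ℝ 2 R (q u)) (hq : DifferentiableAt ℝ q u)
    (hq_symm : DifferentiableAt ℝ q.symm (q u)) (hu : u ∈ K') (v : Vec d) :
    HasFDerivAt (fun z => bregmanDiv R (q v) (q z)) (-innerSL ℝ (pullbackDirection q v u)) u := by
  have hJ : IsUnit (jacobianMatrix q u) :=
    .of_mul_eq_one_right _ (jacobianMatrix_symm_mul (hK' hu) hq hq_symm)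
  refine ((hasFDerivAt_bregmanDiv hR_contDiff (q v)).comp u hq.hasFDerivAt).congr_fderiv ?_
  ext a
  have hisometry := hR.fderiv_fderiv_eq_inner hu hJ a (pullbackDirection q v u)
  rw [fderiv_pullbackDirection (hK' hu) hq hq_symm, real_inner_comm] at hisometry
  simp [← hisometry]

namespace IsReparametrizedLoss

variable {GF : ℝ} {g f : Vec d → ℝ}

theorem hasFDerivWithinAt (h : IsReparametrizedLoss q K' GF g f) (hK' : K' ⊆ q.source)
    (hq_symm : DifferentiableAt ℝ q.symm (q u)) (hu : u ∈ K') :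
    HasFDerivWithinAt f (fderiv ℝ g u ∘L fderiv ℝ q.symm (q u)) (q '' K') (q u) := by
  have hg : HasFDerivAt g (fderiv ℝ g u) (q.symm (q u)) := by
    rw [q.left_inv (hK' hu)]
    exact (h.differentiable u hu).hasFDerivAt
  have heq : EqOn f (g ∘ q.symm) (q '' K') := by
    rintro _ ⟨z, hz, rfl⟩
    rw [Function.comp_apply, q.left_inv (hK' hz), h.comp_eq z hz]
  exact (hg.comp (q u) hq_symm.hasFDerivAt).hasFDerivWithinAt.congr heq
    (heq (mem_image_of_mem q hu))

theorem differentiableOn (h : IsReparametrizedLoss q K' GF g f) (hK' : K' ⊆ q.source)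
    (hq_symm : DifferentiableOn ℝ q.symm q.target) : DifferentiableOn ℝ f (q '' K') := by
  rintro _ ⟨u, hu, rfl⟩
  have hqu : q.target ∈ 𝓝 (q u) := q.open_target.mem_nhds (q.map_source (hK' hu))
  exact (h.hasFDerivWithinAt hK' (hq_symm.differentiableAt hqu) hu).differentiableWithinAt

theorem inner_gradient_pullbackDirection_le (h : IsReparametrizedLoss q K' GF g f)
    (hK' : K' ⊆ q.source) (hq_symm : DifferentiableAt ℝ q.symm (q u)) {v : Vec d} (hu : u ∈ K')
    (hv : v ∈ K') : inner ℝ (gradient g u) (pullbackDirection q v u) ≤ g v - g u := by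
  rw [inner_gradient_left, h.comp_eq u hu, h.comp_eq v hv]
  exact apply_sub_le_sub_of_convexOn h.convex (h.hasFDerivWithinAt hK' hq_symm hu)
    (mem_image_of_mem q hu) (mem_image_of_mem q hv)

end IsReparametrizedLoss

namespace IsRegularizer

variable {K : Set (Vec d)} {x y : Vec d}

theorem contDiffAt (h : IsRegularizer K R) (hx : x ∈ K) : ContDiffAt ℝ 3 R x := by
  obtain ⟨V, hV, hKV, hR⟩ := h.smooth
  exact hR.contDiffAt (hV.mem_nhds (hKV hx))

theorem convexOn (h : IsRegularizer K R) : ConvexOn ℝ K R := by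
  obtain ⟨m, hm, hR⟩ := h.strongConvex
  exact UniformConvexOn.convexOn hR fun r => by positivity

theorem bregmanDiv_nonneg (h : IsRegularizer K R) (hx : x ∈ K) (hy : y ∈ K) :
    0 ≤ bregmanDiv R x y :=
  bregmanDiv_nonneg_of_convexOn h.convexOn hx hy ((h.contDiffAt hy).differentiableAt three_ne_zero)

end IsRegularizer

theorem regret_le_of_forall_sub_le {K : Set (Vec d)} (hK : K.Nonempty) {T : ℕ}
    {g : ℕ → Vec d → ℝ} {u : ℕ → Vec d} {B : ℝ}
    (h : ∀ v ∈ K, ∑ t ∈ Finset.Icc 1 T, (g t (u t) - g t v) ≤ B) : regret K T g u ≤ B := by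
  rw [regret, sub_le_comm]
  refine le_csInf (hK.image _) (forall_mem_image.2 fun v hv => ?_)
  rw [sub_le_comm, ← Finset.sum_sub_distrib]
  exact h v hv

namespace IsOGDRun

variable {η : ℝ} {T : ℕ} {g f : ℕ → Vec d → ℝ} {u : ℕ → Vec d}

theorem succ_mem {K : Set (Vec d)} (h : IsOGDRun K η T g u) {n : ℕ} (hn : n ≤ T) :
    u (n + 1) ∈ K := by
  rcases n.eq_zero_or_pos with rfl | hpos
  · exact h.1
  · exact (h.2 n (Finset.mem_Icc.2 ⟨hpos, hn⟩)).1

theorem mem {K : Set (Vec d)} (h : IsOGDRun K η T g u) {t : ℕ} (ht : t ∈ Finset.Icc 1 T) :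
    u t ∈ K := by
  obtain ⟨hpos, htT⟩ := Finset.mem_Icc.1 ht
  obtain ⟨n, rfl⟩ := Nat.exists_eq_add_of_le' hpos
  exact h.succ_mem (n.le_succ.trans htT)

theorem potential_sub_le {K : Set (Vec d)} (h : IsOGDRun K η T g u) (hK : Convex ℝ K)
    {w : Vec d → Vec d} {Φ : Vec d → ℝ} {L : ℝ≥0} {G : ℝ}
    (hΦ : ∀ z ∈ K, HasFDerivWithinAt Φ (-innerSL ℝ (w z)) K z) (hw : LipschitzOnWith L w K)
    (htan : ∀ z ∈ K, w z ∈ posTangentConeAt K z) (hη : 0 ≤ η)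
    (hG : ∀ t ∈ Finset.Icc 1 T, ‖gradient (g t) (u t)‖ ≤ G) :
    Φ (u (T + 1)) - Φ (u 1) ≤
      η * ∑ t ∈ Finset.Icc 1 T, inner ℝ (gradient (g t) (u t)) (w (u t))
        + T * (4 * L * (η * G) ^ 2) := by
  rcases T.eq_zero_or_pos with rfl | hT
  · simp
  calc Φ (u (T + 1)) - Φ (u 1)
      = ∑ t ∈ Finset.Icc 1 T, (Φ (u (t + 1)) - Φ (u t)) :=
        (Finset.sum_Icc_sub hT fun t => Φ (u t)).symm
    _ ≤ ∑ t ∈ Finset.Icc 1 T,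
          (η * inner ℝ (gradient (g t) (u t)) (w (u t)) + 4 * L * (η * G) ^ 2) :=
        Finset.sum_le_sum fun t ht => potential_sub_le_of_projected_step hK hΦ hw hη (h.mem ht)
          (h.2 t ht).1 (htan _ (h.2 t ht).1) (hG t ht) (h.2 t ht).2
    _ = _ := by simp [Finset.sum_add_distrib, Finset.mul_sum]

theorem mul_sum_sub_le (h : IsOGDRun K' η T g u) (hη : 0 ≤ η) (hK'_convex : Convex ℝ K')
    (hK' : K' ⊆ q.source) (hq : DifferentiableOn ℝ q q.source)
    (hq_symm : DifferentiableOn ℝ q.symm q.target) (hR_reg : IsRegularizer (q '' K') R)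
    (hR : HessianJacobianRelation q K' (q '' K') R) {D GF : ℝ} {L : ℝ≥0}
    (hD : ∀ x ∈ q '' K', ∀ y ∈ q '' K', bregmanDiv R x y ≤ D)
    (hg : ∀ t ∈ Finset.Icc 1 T, IsReparametrizedLoss q K' GF (g t) (f t)) {v : Vec d}
    (hv : v ∈ K') (hL : LipschitzOnWith L (pullbackDirection q v) K') :
    η * ∑ t ∈ Finset.Icc 1 T, (g t (u t) - g t v) ≤ D + T * (4 * L * (η * GF) ^ 2) := by
  have hq_at : ∀ z ∈ K', DifferentiableAt ℝ q z := fun z hz =>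
    hq.differentiableAt (q.open_source.mem_nhds (hK' hz))
  have hq_symm_at : ∀ z ∈ K', DifferentiableAt ℝ q.symm (q z) := fun z hz =>
    hq_symm.differentiableAt (q.open_target.mem_nhds (q.map_source (hK' hz)))
  have hpotential := h.potential_sub_le hK'_convex
    (fun z hz => (hasFDerivAt_bregmanDiv_comp hR hK'
      ((hR_reg.contDiffAt (mem_image_of_mem q hz)).of_le (by norm_num)) (hq_at z hz)
      (hq_symm_at z hz) hz v).hasFDerivWithinAt) hL
    (fun z hz => pullbackDirection_mem_posTangentConeAt hK' hR_reg.convexOn.1 (hq_symm_at z hz)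
      hz hv) hη (fun t ht => (hg t ht).gradient_le _ (h.mem ht))
  have hloss : ∑ t ∈ Finset.Icc 1 T, (g t (u t) - g t v) ≤
      -∑ t ∈ Finset.Icc 1 T, inner ℝ (gradient (g t) (u t)) (pullbackDirection q v (u t)) := by
    rw [← Finset.sum_neg_distrib]
    refine Finset.sum_le_sum fun t ht => ?_
    rw [le_neg, neg_sub]
    have hut := h.mem ht
    exact (hg t ht).inner_gradient_pullbackDirection_le hK' (hq_symm_at _ hut) hut hv
  have hfirst : bregmanDiv R (q v) (q (u 1)) ≤ D :=
    hD _ (mem_image_of_mem q hv) _ (mem_image_of_mem q h.1)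
  have hlast : 0 ≤ bregmanDiv R (q v) (q (u (T + 1))) :=
    hR_reg.bregmanDiv_nonneg (mem_image_of_mem q hv) (mem_image_of_mem q (h.succ_mem le_rfl))
  linarith [mul_le_mul_of_nonneg_left hloss hη]

end IsOGDRun

theorem le_mul_rpow_of_mul_le {D A c S T : ℝ} (hA : 0 ≤ A) (hc : 0 < c) (hT : 1 ≤ T)
    (h : c * T ^ (-(2 / 3) : ℝ) * S ≤ D + T * (A * (c * T ^ (-(2 / 3) : ℝ)) ^ 2)) :
    S ≤ (D / c + A * c) * T ^ (2 / 3 : ℝ) := by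
  set τ : ℝ := T ^ (2 / 3 : ℝ) with hτ_def
  have hT₀ : 0 ≤ T := zero_le_one.trans hT
  have hτ : 0 < τ := Real.rpow_pos_of_pos (one_pos.trans_le hT) _
  have hTτ : T ≤ τ ^ 2 := by
    rw [hτ_def, ← Real.rpow_natCast, ← Real.rpow_mul hT₀]
    exact Real.self_le_rpow_of_one_le hT (by norm_num)
  rw [Real.rpow_neg hT₀, ← hτ_def] at h
  have herror : T * (A * (c * τ⁻¹) ^ 2) ≤ A * c ^ 2 := by
    calc T * (A * (c * τ⁻¹) ^ 2) ≤ τ ^ 2 * (A * (c * τ⁻¹) ^ 2) := by gcongr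
      _ = A * c ^ 2 := by field_simp
  calc S = τ / c * (c * τ⁻¹ * S) := by field_simp
    _ ≤ τ / c * (D + A * c ^ 2) := by gcongr; linarith
    _ = (D / c + A * c) * τ := by field_simp

theorem exists_regret_le_mul_rpow (hK'_convex : Convex ℝ K') (hK'_compact : IsCompact K')
    (hK' : K' ⊆ q.source) (hq : ContDiffOn ℝ 1 q q.source)
    (hq_symm : ContDiffOn ℝ 2 q.symm q.target)
    (hR_reg : IsRegularizer (q '' K') R) (hR : HessianJacobianRelation q K' (q '' K') R)
    (GF : ℝ) {c : ℝ} (hc : 0 < c) :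
    ∃ C : ℝ, ∀ T : ℕ, 1 ≤ T → ∀ g f : ℕ → Vec d → ℝ,
      (∀ t ∈ Finset.Icc 1 T, IsReparametrizedLoss q K' GF (g t) (f t)) →
      ∀ u : ℕ → Vec d, IsOGDRun K' (c * (T : ℝ) ^ (-(2 / 3) : ℝ)) T g u →
        regret K' T g u ≤ C * (T : ℝ) ^ (2 / 3 : ℝ) := by
  obtain ⟨D, hD⟩ := hR_reg.bounded
  obtain ⟨L, hL⟩ := exists_lipschitzOnWith_pullbackDirection hK'_convex hK'_compact hK' hq hq_symm
  refine ⟨D / c + 4 * L * GF ^ 2 * c, fun T hT g f hg u hu => ?_⟩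
  refine regret_le_of_forall_sub_le ⟨u 1, hu.1⟩ fun v hv => ?_
  refine le_mul_rpow_of_mul_le (by positivity) hc (by exact_mod_cast hT) ?_
  convert hu.mul_sum_sub_le (by positivity) hK'_convex hK' (hq.differentiableOn one_ne_zero)
    (hq_symm.differentiableOn two_ne_zero) hR_reg hR hD hg hv (hL v hv) using 3
  ring

end MirrorDescent

section Diagonal

variable {d : ℕ} {p : Vec d → Vec d}

/-- On `N`, the map `p` is the product of the scalar maps `κ i`: the `i`-th coordinate of `p u` is
`κ i` at the `i`-th coordinate of `u`. The values of `κ i` off the `i`-th projection of `N` are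
irrelevant. -/
def ActsCoordinatewiseOn (κ : Fin d → ℝ → ℝ) (p : Vec d → Vec d) (N : Set (Vec d)) : Prop :=
  ∀ u ∈ N, ∀ i, p u i = κ i (u i)

theorem fderiv_apply_of_isDiag {u : Vec d} (h : (jacobianMatrix p u).IsDiag) (v : Vec d)
    (i : Fin d) : fderiv ℝ p u v i = jacobianMatrix p u i i * v i := by
  rw [ofLp_fderiv_apply, ← h.diagonal_diag, Matrix.mulVec_diagonal, Matrix.diagonal_apply_eq]

theorem apply_eq_apply_of_isDiag {N : Set (Vec d)} (hN : Convex ℝ N)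
    (hp : ∀ u ∈ N, DifferentiableAt ℝ p u) (hdiag : ∀ u ∈ N, (jacobianMatrix p u).IsDiag)
    {u v : Vec d} (hu : u ∈ N) (hv : v ∈ N) {i : Fin d} (huv : u i = v i) : p u i = p v i := by
  have hderiv : ∀ z ∈ N, HasFDerivWithinAt (fun z => p z i)
      (EuclideanSpace.proj i ∘L fderiv ℝ p z) N z := fun z hz =>
    ((EuclideanSpace.proj i : Vec d →L[ℝ] ℝ).hasFDerivAt.comp z
      (hp z hz).hasFDerivAt).hasFDerivWithinAt
  obtain ⟨z, hz, hmvt⟩ := domain_mvt hderiv hN hv hu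
  have hzero : fderiv ℝ p z (u - v) i = 0 := by
    rw [fderiv_apply_of_isDiag (hdiag z (hN.segment_subset hv hu hz)), PiLp.sub_apply, huv,
      sub_self, mul_zero]
  exact sub_eq_zero.1 (hmvt.trans hzero)

theorem exists_actsCoordinatewiseOn {U K : Set (Vec d)} (hU : IsOpen U)
    (hp : DifferentiableOn ℝ p U) (hdiag : ∀ u ∈ U, (jacobianMatrix p u).IsDiag)
    (hK_convex : Convex ℝ K) (hK_compact : IsCompact K) (hKU : K ⊆ U) :
    ∃ N κ, IsOpen N ∧ Convex ℝ N ∧ K ⊆ N ∧ N ⊆ U ∧ ActsCoordinatewiseOn κ p N := by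
  obtain ⟨ε, hε, hεU⟩ := hK_compact.exists_thickening_subset_open hU hKU
  set N := Metric.thickening ε K
  have hN : Convex ℝ N := hK_convex.thickening ε
  have hfactors : ∀ i, Function.FactorsThrough (fun u : N => p u i) fun u : N => u.1 i :=
    fun i u v huv => apply_eq_apply_of_isDiag hN
      (fun z hz => hp.differentiableAt (hU.mem_nhds (hεU hz))) (fun z hz => hdiag z (hεU hz))
      u.2 v.2 huv
  exact ⟨N, fun i => Function.extend (fun u : N => u.1 i) (fun u => p u i) 0,
    Metric.isOpen_thickening, hN, Metric.self_subset_thickening hε K, hεU,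
    fun u hu i => ((hfactors i).extend_apply 0 ⟨u, hu⟩).symm⟩

namespace ActsCoordinatewiseOn

variable {κ : Fin d → ℝ → ℝ} {N : Set (Vec d)} {u : Vec d}

theorem eventuallyEq (h : ActsCoordinatewiseOn κ p N) (hN : IsOpen N) (hu : u ∈ N) (i : Fin d) :
    κ i =ᶠ[𝓝 (u i)] fun s => p (u + (s - u i) • EuclideanSpace.single i 1) i := by
  have hline : Continuous fun s : ℝ => u + (s - u i) • EuclideanSpace.single i (1 : ℝ) := by
    fun_prop
  have hmem : ∀ᶠ s in 𝓝 (u i), u + (s - u i) • EuclideanSpace.single i (1 : ℝ) ∈ N :=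
    hline.continuousAt.eventually_mem (by simpa using hN.mem_nhds hu)
  filter_upwards [hmem] with s hs
  simpa using (h _ hs i).symm

theorem contDiffAt (h : ActsCoordinatewiseOn κ p N) (hN : IsOpen N) (hu : u ∈ N)
    {n : WithTop ℕ∞} (hp : ContDiffAt ℝ n p u) (i : Fin d) : ContDiffAt ℝ n (κ i) (u i) := by
  refine ContDiffAt.congr_of_eventuallyEq ?_ (h.eventuallyEq hN hu i)
  refine (EuclideanSpace.proj i : Vec d →L[ℝ] ℝ).contDiff.contDiffAt.comp (u i)
    (ContDiffAt.comp (u i) (by simpa using hp) ?_)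
  fun_prop

theorem deriv_eq (h : ActsCoordinatewiseOn κ p N) (hN : IsOpen N) (hu : u ∈ N)
    (hp : DifferentiableAt ℝ p u) (i : Fin d) : deriv (κ i) (u i) = jacobianMatrix p u i i := by
  rw [(h.eventuallyEq hN hu i).deriv_eq]
  have hline : HasDerivAt (fun s : ℝ => u + (s - u i) • EuclideanSpace.single i (1 : ℝ))
      (EuclideanSpace.single i 1) (u i) := by
    simpa using (((hasDerivAt_id (u i)).sub_const (u i)).smul_const
      (EuclideanSpace.single i (1 : ℝ))).const_add u
  have hp' : HasFDerivAt p (fderiv ℝ p u) (u + (u i - u i) • EuclideanSpace.single i (1 : ℝ)) := by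
    simpa using hp.hasFDerivAt
  exact ((EuclideanSpace.proj i : Vec d →L[ℝ] ℝ).hasFDerivAt.comp_hasDerivAt (u i)
    (hp'.comp_hasDerivAt (u i) hline)).deriv

end ActsCoordinatewiseOn

theorem isDiag_of_mul_eq_one {n k : Type*} [Fintype n] [DecidableEq n] [CommRing k]
    {A B : Matrix n n k} (hB : B.IsDiag) (h : A * B = 1) : A.IsDiag := by
  rw [← Matrix.inv_eq_left_inv h, ← hB.diagonal_diag, Matrix.inv_diagonal]
  exact Matrix.isDiag_diagonal _

theorem apply_mul_apply_of_mul_eq_one {n k : Type*} [Fintype n] [DecidableEq n] [Semiring k]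
    {A B : Matrix n n k} (hB : B.IsDiag) (h : A * B = 1) (i : n) : A i i * B i i = 1 := by
  rw [← hB.diagonal_diag] at h
  simpa [Matrix.mul_diagonal] using congrFun₂ h i i

end Diagonal

section Separable

variable {ι : Type*} [Fintype ι] {ρ : ι → ℝ → ℝ}

/-- The separable function `x ↦ ∑ i, ρ i (x i)` on Euclidean space. -/
def separableSum (ρ : ι → ℝ → ℝ) (x : EuclideanSpace ℝ ι) : ℝ :=
  ∑ i, ρ i (x i)

theorem contDiffAt_separableSum {n : WithTop ℕ∞} {x : EuclideanSpace ℝ ι}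
    (h : ∀ i, ContDiffAt ℝ n (ρ i) (x i)) : ContDiffAt ℝ n (separableSum ρ) x :=
  ContDiffAt.sum fun i _ =>
    (h i).comp x (EuclideanSpace.proj i : EuclideanSpace ℝ ι →L[ℝ] ℝ).contDiff.contDiffAt

theorem fderiv_separableSum {x : EuclideanSpace ℝ ι} (h : ∀ i, DifferentiableAt ℝ (ρ i) (x i)) :
    fderiv ℝ (separableSum ρ) x = ∑ i, deriv (ρ i) (x i) • EuclideanSpace.proj i :=
  (HasFDerivAt.fun_sum fun i _ => (h i).hasDerivAt.comp_hasFDerivAt x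
    (EuclideanSpace.proj i : EuclideanSpace ℝ ι →L[ℝ] ℝ).hasFDerivAt).fderiv

theorem hessianMatrix_separableSum {d : ℕ} {ρ : Fin d → ℝ → ℝ} {x : Vec d}
    (h : ∀ i, ContDiffAt ℝ 2 (ρ i) (x i)) :
    hessianMatrix (separableSum ρ) x = Matrix.diagonal fun i => deriv (deriv (ρ i)) (x i) := by
  have hnear : fderiv ℝ (separableSum ρ) =ᶠ[𝓝 x]
      fun y => ∑ i, deriv (ρ i) (y i) • EuclideanSpace.proj i := by
    have hev : ∀ i, ∀ᶠ y : Vec d in 𝓝 x, ContDiffAt ℝ 2 (ρ i) (y i) := fun i =>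
      (EuclideanSpace.proj i : Vec d →L[ℝ] ℝ).continuous.continuousAt.eventually
        ((h i).eventually (by simp))
    filter_upwards [eventually_all.2 hev] with y hy
    exact fderiv_separableSum fun i => (hy i).differentiableAt two_ne_zero
  have hderiv : ∀ i, HasDerivAt (deriv (ρ i)) (deriv (deriv (ρ i)) (x i)) (x i) := fun i =>
    (((h i).derivWithin one_add_one_eq_two.le).differentiableAt one_ne_zero).hasDerivAt
  have hcoord : ∀ i, HasFDerivAt (fun y : Vec d => deriv (ρ i) (y i))
      (deriv (deriv (ρ i)) (x i) • (EuclideanSpace.proj i : Vec d →L[ℝ] ℝ)) x := fun i =>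
    HasDerivAt.comp_hasFDerivAt (h₂ := deriv (ρ i)) x (hderiv i)
      (EuclideanSpace.proj i : Vec d →L[ℝ] ℝ).hasFDerivAt
  have hsecond := HasFDerivAt.fun_sum (u := Finset.univ) fun i _ =>
    (hcoord i).smul_const (EuclideanSpace.proj i : Vec d →L[ℝ] ℝ)
  ext i j
  rw [hessianMatrix, Matrix.of_apply, hnear.fderiv_eq, hsecond.fderiv]
  simp [Matrix.diagonal_apply, PiLp.single_apply]

theorem strongConvexOn_of_le_deriv_deriv {D : Set ℝ} (hD : Convex ℝ D) {f : ℝ → ℝ} {m : ℝ}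
    (hf : ∀ x ∈ D, ContDiffAt ℝ 2 f x) (hm : ∀ x ∈ D, m ≤ deriv (deriv f) x) :
    StrongConvexOn D m f := by
  have hf₁ : ∀ x ∈ D, HasDerivAt (fun x => f x - m / 2 * ‖x‖ ^ 2) (deriv f x - m * x) x := by
    intro x hx
    have hsq := (hasDerivAt_pow 2 x).const_mul (m / 2)
    simp only [Real.norm_eq_abs, sq_abs]
    refine (((hf x hx).differentiableAt two_ne_zero).hasDerivAt.fun_sub hsq).congr_deriv ?_
    push_cast
    ring
  have hf₂ : ∀ x ∈ D, HasDerivAt (fun x => deriv f x - m * x) (deriv (deriv f) x - m) x := by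
    intro x hx
    have hderiv := ((hf x hx).derivWithin one_add_one_eq_two.le).differentiableAt one_ne_zero
    simpa using hderiv.hasDerivAt.fun_sub ((hasDerivAt_id x).const_mul m)
  rw [strongConvexOn_iff_convex]
  exact convexOn_of_hasDerivWithinAt2_nonneg hD
    (fun x hx => (hf₁ x hx).continuousAt.continuousWithinAt)
    (fun x hx => (hf₁ x (interior_subset hx)).hasDerivWithinAt)
    (fun x hx => (hf₂ x (interior_subset hx)).hasDerivWithinAt)
    fun x hx => sub_nonneg.2 (hm x (interior_subset hx))

theorem strongConvexOn_separableSum {K : Set (EuclideanSpace ℝ ι)} (hK : Convex ℝ K) {m : ℝ}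
    (h : ∀ i, StrongConvexOn ((fun x : EuclideanSpace ℝ ι => x i) '' K) m (ρ i)) :
    StrongConvexOn K m (separableSum ρ) := by
  refine ⟨hK, fun x hx y hy a b ha hb hab => ?_⟩
  have hcoord : ∀ i, ρ i ((a • x + b • y) i) ≤
      a * ρ i (x i) + b * ρ i (y i) - a * b * (m / 2 * ‖x i - y i‖ ^ 2) := fun i =>
    (h i).2 (mem_image_of_mem _ hx) (mem_image_of_mem _ hy) ha hb hab
  calc separableSum ρ (a • x + b • y)
      ≤ ∑ i, (a * ρ i (x i) + b * ρ i (y i) - a * b * (m / 2 * ‖x i - y i‖ ^ 2)) :=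
        Finset.sum_le_sum fun i _ => hcoord i
    _ = _ := by
        simp [separableSum, EuclideanSpace.norm_sq_eq, Finset.sum_add_distrib,
          Finset.sum_sub_distrib, Finset.mul_sum]

end Separable

section Primitive

theorem exists_contDiffOn_deriv_eq {J : Set ℝ} (hJ : IsOpen J) (hJ_conn : J.OrdConnected) {n : ℕ}
    {h : ℝ → ℝ} (hh : ContDiffOn ℝ n h J) :
    ∃ H : ℝ → ℝ, ContDiffOn ℝ (n + 1 : ℕ) H J ∧ EqOn (deriv H) h J := by
  rcases J.eq_empty_or_nonempty with rfl | ⟨a, ha⟩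
  · exact ⟨0, by simp⟩
  have hderiv : ∀ x ∈ J, HasDerivAt (fun x => ∫ t in a..x, h t) (h x) x := fun x hx =>
    intervalIntegral.integral_hasDerivAt_right
      (hh.continuousOn.mono (hJ_conn.uIcc_subset ha hx)).intervalIntegrable
      (hh.continuousOn.stronglyMeasurableAtFilter hJ x hx)
      (hh.continuousOn.continuousAt (hJ.mem_nhds hx))
  refine ⟨fun x => ∫ t in a..x, h t, ?_, fun x hx => (hderiv x hx).deriv⟩
  push_cast
  rw [contDiffOn_succ_iff_deriv_of_isOpen hJ]
  exact ⟨fun x hx => (hderiv x hx).differentiableAt.differentiableWithinAt, by simp,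
    hh.congr fun x hx => (hderiv x hx).deriv⟩

theorem exists_contDiffOn_deriv_deriv_eq {J : Set ℝ} (hJ : IsOpen J) (hJ_conn : J.OrdConnected)
    {n : ℕ} {h : ℝ → ℝ} (hh : ContDiffOn ℝ n h J) :
    ∃ ρ : ℝ → ℝ, ContDiffOn ℝ (n + 2 : ℕ) ρ J ∧ EqOn (deriv (deriv ρ)) h J := by
  obtain ⟨H, hH, hH_deriv⟩ := exists_contDiffOn_deriv_eq hJ hJ_conn hh
  obtain ⟨ρ, hρ, hρ_deriv⟩ := exists_contDiffOn_deriv_eq hJ hJ_conn hH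
  exact ⟨ρ, hρ, (hρ_deriv.deriv hJ).trans hH_deriv⟩

end Primitive

theorem deriv_deriv_comp {g f : ℝ → ℝ} {x : ℝ} (hg : ContDiffAt ℝ 2 g (f x))
    (hf : ContDiffAt ℝ 2 f x) :
    deriv (deriv (g ∘ f)) x =
      deriv (deriv g) (f x) * deriv f x ^ 2 + deriv g (f x) * deriv (deriv f) x := by
  simpa only [iteratedDeriv_succ, iteratedDeriv_zero] using iteratedDeriv_comp_two hg hf

section Regularizer

variable {d : ℕ} {K K' : Set (Vec d)} {ρ : Fin d → ℝ → ℝ}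

theorem exists_pos_forall_le_deriv_deriv (hK : IsCompact K)
    (hρ : ∀ y ∈ K, ∀ i, ContDiffAt ℝ 2 (ρ i) (y i))
    (hpos : ∀ y ∈ K, ∀ i, 0 < deriv (deriv (ρ i)) (y i)) :
    ∃ m, 0 < m ∧ ∀ i, ∀ y ∈ K, m ≤ deriv (deriv (ρ i)) (y i) := by
  have hcont : ∀ i, ContinuousOn (fun y : Vec d => deriv (deriv (ρ i)) (y i)) K := by
    intro i y hy
    have hderiv : ContDiffAt ℝ 1 (deriv (ρ i)) (y i) :=
      (hρ y hy i).derivWithin one_add_one_eq_two.le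
    have hderiv₂ : ContDiffAt ℝ 0 (deriv (deriv (ρ i))) (y i) :=
      hderiv.derivWithin (zero_add 1).le
    exact (ContinuousAt.comp (f := fun z : Vec d => z i) hderiv₂.continuousAt
      (EuclideanSpace.proj i : Vec d →L[ℝ] ℝ).continuous.continuousAt).continuousWithinAt
  choose m hm hle using fun i => hK.exists_forall_le' (hcont i) fun y hy => hpos y hy i
  have hsmall : ∀ᶠ c in 𝓝[>] (0 : ℝ), ∀ i, c ≤ m i :=
    eventually_all.2 fun i => mem_of_superset (Ioc_mem_nhdsGT (hm i)) fun c hc => hc.2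
  obtain ⟨c, hcm, hc⟩ := (hsmall.and self_mem_nhdsWithin).exists
  exact ⟨c, hc, fun i y hy => (hcm i).trans (hle i y hy)⟩

theorem isRegularizer_separableSum (hK_convex : Convex ℝ K) (hK_compact : IsCompact K)
    (hρ : ∀ y ∈ K, ∀ i, ContDiffAt ℝ 3 (ρ i) (y i))
    (hpos : ∀ y ∈ K, ∀ i, 0 < deriv (deriv (ρ i)) (y i)) : IsRegularizer K (separableSum ρ) := by
  have hρ₂ : ∀ y ∈ K, ∀ i, ContDiffAt ℝ 2 (ρ i) (y i) := fun y hy i =>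
    (hρ y hy i).of_le (by norm_num)
  set V := {x | ContDiffAt ℝ 3 (separableSum ρ) x}
  have hV : IsOpen V := isOpen_iff_mem_nhds.2 fun x hx => ContDiffAt.eventually hx (by simp)
  have hKV : K ⊆ V := fun y hy => contDiffAt_separableSum (hρ y hy)
  have hR : ContDiffOn ℝ 3 (separableSum ρ) V := fun x hx => ContDiffAt.contDiffWithinAt hx
  obtain ⟨m, hm, hle⟩ := exists_pos_forall_le_deriv_deriv hK_compact hρ₂ hpos
  have hconvex : StrongConvexOn K m (separableSum ρ) :=
    strongConvexOn_separableSum hK_convex fun i => strongConvexOn_of_le_deriv_deriv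
      (hK_convex.linear_image (EuclideanSpace.proj i : Vec d →L[ℝ] ℝ).toLinearMap)
      (forall_mem_image.2 fun y hy => hρ₂ y hy i) (forall_mem_image.2 (hle i))
  exact ⟨⟨V, hV, hKV, hR⟩, ⟨m, hm, hconvex⟩,
    exists_bregmanDiv_le hV (hR.of_le (by norm_num)) hK_compact hKV⟩

theorem hessianJacobianRelation_separableSum {q : Vec d → Vec d} (hq : InjOn q K')
    (hdiag : ∀ u ∈ K', (jacobianMatrix q u).IsDiag)
    (hρ : ∀ u ∈ K', ∀ i, ContDiffAt ℝ 2 (ρ i) (q u i))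
    (hρ_deriv : ∀ u ∈ K', ∀ i, deriv (deriv (ρ i)) (q u i) * jacobianMatrix q u i i ^ 2 = 1) :
    HessianJacobianRelation q K' (q '' K') (separableSum ρ) := by
  refine ⟨hq.bijOn_image, fun u hu => Matrix.inv_eq_right_inv ?_⟩
  rw [hessianMatrix_separableSum (hρ u hu), ← (hdiag u hu).diagonal_diag,
    Matrix.diagonal_transpose, Matrix.diagonal_mul_diagonal, Matrix.diagonal_mul_diagonal,
    ← Matrix.diagonal_one]
  congr 1 with i
  rw [Matrix.diag_apply, ← sq, hρ_deriv u hu i]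

theorem solvesCoordinateODEs_separableSum {q : Vec d → Vec d} {N : Set (Vec d)}
    {κ : Fin d → ℝ → ℝ} (hN : IsOpen N) (hK'N : K' ⊆ N) (hκ : ActsCoordinatewiseOn κ q N)
    (hq : ∀ u ∈ K', ContDiffAt ℝ 3 q u) (hρ : ∀ u ∈ K', ∀ i, ContDiffAt ℝ 3 (ρ i) (q u i))
    (hρ_deriv : ∀ u ∈ K', ∀ i, deriv (deriv (ρ i)) (q u i) * jacobianMatrix q u i i ^ 2 = 1) :
    SolvesCoordinateODEs q K' (separableSum ρ) := by
  refine ⟨κ, ρ, ⟨N, hN, hK'N, hκ⟩, fun x => rfl, fun i => forall_mem_image.2 fun u hu => ?_⟩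
  have hκ_contDiff : ContDiffAt ℝ 3 (κ i) (u i) := hκ.contDiffAt hN (hK'N hu) (hq u hu) i
  have hρ_contDiff := hρ u hu i
  have hunit := hρ_deriv u hu i
  rw [← hκ.deriv_eq hN (hK'N hu) ((hq u hu).differentiableAt three_ne_zero) i,
    hκ u (hK'N hu) i] at hunit
  rw [hκ u (hK'N hu) i] at hρ_contDiff
  refine ⟨hκ_contDiff, hρ_contDiff, ?_⟩
  rw [deriv_deriv_comp (hρ_contDiff.of_le (by norm_num)) (hκ_contDiff.of_le (by norm_num)),
    deriv_comp _ (hρ_contDiff.differentiableAt three_ne_zero)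
      (hκ_contDiff.differentiableAt three_ne_zero)]
  -- By the chain rule the equation reads `κ' * (ρ'' * κ' ^ 2 - 1) = 0`.
  linear_combination deriv (κ i) (u i) * hunit

theorem exists_contDiffAt_deriv_deriv_eq_sq {p : Vec d → Vec d} {U : Set (Vec d)} {n : ℕ}
    (hU : IsOpen U) (hp : ContDiffOn ℝ (n + 1) p U) (hdiag : ∀ y ∈ U, (jacobianMatrix p y).IsDiag)
    (hK_convex : Convex ℝ K) (hK_compact : IsCompact K) (hKU : K ⊆ U) :
    ∃ ρ : Fin d → ℝ → ℝ, ∀ y ∈ K, ∀ i,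
      ContDiffAt ℝ (n + 2) (ρ i) (y i) ∧
        deriv (deriv (ρ i)) (y i) = jacobianMatrix p y i i ^ 2 := by
  have hp_diff : DifferentiableOn ℝ p U := hp.differentiableOn (by simp)
  obtain ⟨N, κ, hN, hN_convex, hKN, hNU, hκ⟩ :=
    exists_actsCoordinatewiseOn hU hp_diff hdiag hK_convex hK_compact hKU
  have hJ : ∀ i, IsOpen ((fun y : Vec d => y i) '' N) := fun i =>
    PiLp.isOpenMap_apply 2 _ i N hN
  have hJ_conn : ∀ i, ((fun y : Vec d => y i) '' N).OrdConnected := fun i =>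
    (hN_convex.linear_image (EuclideanSpace.proj i : Vec d →L[ℝ] ℝ).toLinearMap).ordConnected
  have hκ_sq : ∀ i, ContDiffOn ℝ n (fun s => deriv (κ i) s ^ 2) ((fun y : Vec d => y i) '' N) :=
    fun i => forall_mem_image.2 fun y hy =>
      (((hκ.contDiffAt hN hy (hp.contDiffAt (hU.mem_nhds (hNU hy))) i).derivWithin
        le_rfl).pow 2).contDiffWithinAt
  choose ρ hρ hρ_deriv using fun i => exists_contDiffOn_deriv_deriv_eq (hJ i) (hJ_conn i) (hκ_sq i)
  refine ⟨ρ, fun y hy i => ?_⟩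
  have hyJ := mem_image_of_mem (fun y : Vec d => y i) (hKN hy)
  refine ⟨by exact_mod_cast (hρ i).contDiffAt ((hJ i).mem_nhds hyJ), ?_⟩
  rw [hρ_deriv i hyJ, ← hκ.deriv_eq hN (hKN hy) (hp_diff.differentiableAt (hU.mem_nhds (hKU hy)))]

theorem exists_contDiffAt_deriv_deriv_mul_sq_eq_one
    {q : OpenPartialHomeomorph (Vec d) (Vec d)} (hK' : K' ⊆ q.source)
    (hq : DifferentiableOn ℝ q q.source) (hq_symm : ContDiffOn ℝ 2 q.symm q.target)
    (hdiag : ∀ u ∈ q.source, (jacobianMatrix q u).IsDiag) (hK_convex : Convex ℝ (q '' K'))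
    (hK_compact : IsCompact (q '' K')) :
    ∃ ρ : Fin d → ℝ → ℝ, ∀ u ∈ K', ∀ i, ContDiffAt ℝ 3 (ρ i) (q u i) ∧
      deriv (deriv (ρ i)) (q u i) * jacobianMatrix q u i i ^ 2 = 1 := by
  have hmul : ∀ u ∈ q.source, jacobianMatrix q.symm (q u) * jacobianMatrix q u = 1 := fun u hu =>
    jacobianMatrix_symm_mul hu (hq.differentiableAt (q.open_source.mem_nhds hu))
      ((hq_symm.differentiableOn two_ne_zero).differentiableAt
        (q.open_target.mem_nhds (q.map_source hu)))
  have hdiag_symm : ∀ y ∈ q.target, (jacobianMatrix q.symm y).IsDiag := by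
    intro y hy
    rw [← q.right_inv hy]
    exact isDiag_of_mul_eq_one (hdiag _ (q.map_target hy)) (hmul _ (q.map_target hy))
  obtain ⟨ρ, hρ⟩ := exists_contDiffAt_deriv_deriv_eq_sq (n := 1) q.open_target
    (by exact_mod_cast hq_symm) hdiag_symm hK_convex hK_compact
    (image_subset_iff.2 fun u hu => q.map_source (hK' hu))
  refine ⟨ρ, fun u hu i => ?_⟩
  obtain ⟨hcontDiff, hderiv⟩ := hρ (q u) (mem_image_of_mem q hu) i
  refine ⟨by exact_mod_cast hcontDiff, ?_⟩
  rw [hderiv, ← mul_pow, apply_mul_apply_of_mul_eq_one (hdiag u (hK' hu)) (hmul u (hK' hu)),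
    one_pow]

end Regularizer

theorem theorem2 {d : ℕ} (K' : Set (Vec d)) (hK'_convex : Convex ℝ K') (hK'_compact : IsCompact K')
    (q : OpenPartialHomeomorph (Vec d) (Vec d)) (hK'_source : K' ⊆ q.source)
    (hq : ContDiffOn ℝ 3 q q.source) (hq_symm : ContDiffOn ℝ 3 q.symm q.target)
    (hq_diag : ∀ u ∈ q.source, (jacobianMatrix q u).IsDiag)
    (hK_convex : Convex ℝ (q '' K')) (hK_compact : IsCompact (q '' K')) :
    ∃ R : Vec d → ℝ,
      IsRegularizer (q '' K') R ∧
      HessianJacobianRelation q K' (q '' K') R ∧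
      SolvesCoordinateODEs q K' R ∧
      ∀ GF : ℝ, 0 ≤ GF → ∀ c : ℝ, 0 < c →
        ∃ C : ℝ, ∀ T : ℕ, 1 ≤ T → ∀ g f : ℕ → Vec d → ℝ,
          (∀ t ∈ Finset.Icc 1 T, IsReparametrizedLoss q K' GF (g t) (f t)) →
          IsOMDObject (q '' K') R T f ∧
          ∀ u : ℕ → Vec d, IsOGDRun K' (c * (T : ℝ) ^ (-(2 / 3) : ℝ)) T g u →
            regret K' T g u ≤ C * (T : ℝ) ^ (2 / 3 : ℝ) := by
  have hq_at : ∀ u ∈ K', ContDiffAt ℝ 3 q u := fun u hu =>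
    hq.contDiffAt (q.open_source.mem_nhds (hK'_source hu))
  have hq_diff : DifferentiableOn ℝ q q.source := hq.differentiableOn three_ne_zero
  have hq_symm₂ : ContDiffOn ℝ 2 q.symm q.target := hq_symm.of_le (by norm_num)
  obtain ⟨N, κ, hN, -, hK'N, -, hκ⟩ := exists_actsCoordinatewiseOn q.open_source hq_diff hq_diag
    hK'_convex hK'_compact hK'_source
  obtain ⟨ρ, hρ⟩ := exists_contDiffAt_deriv_deriv_mul_sq_eq_one hK'_source hq_diff hq_symm₂ hq_diag
    hK_convex hK_compact
  have hρ_contDiff : ∀ u ∈ K', ∀ i, ContDiffAt ℝ 3 (ρ i) (q u i) := fun u hu i => (hρ u hu i).1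
  have hρ_deriv := fun u hu i => (hρ u hu i).2
  have hreg : IsRegularizer (q '' K') (separableSum ρ) :=
    isRegularizer_separableSum hK_convex hK_compact (forall_mem_image.2 hρ_contDiff)
      (forall_mem_image.2 fun u hu i =>
        pos_of_mul_pos_left (one_pos.trans_eq (hρ_deriv u hu i).symm) (sq_nonneg _))
  have hrel : HessianJacobianRelation q K' (q '' K') (separableSum ρ) :=
    hessianJacobianRelation_separableSum (q.injOn.mono hK'_source)
      (fun u hu => hq_diag u (hK'_source hu))
      (fun u hu i => (hρ_contDiff u hu i).of_le (by norm_num)) hρ_deriv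
  refine ⟨separableSum ρ, hreg, hrel,
    solvesCoordinateODEs_separableSum hN hK'N hκ hq_at hρ_contDiff hρ_deriv, fun GF _ c hc => ?_⟩
  obtain ⟨C, hC⟩ := exists_regret_le_mul_rpow hK'_convex hK'_compact hK'_source
    (hq.of_le (by norm_num)) hq_symm₂ hreg hrel GF hc
  exact ⟨C, fun T hT g f hg => ⟨⟨hK_convex, hK_compact, fun t ht => (hg t ht).convex,
    fun t ht => (hg t ht).differentiableOn hK'_source (hq_symm.differentiableOn three_ne_zero),
    hreg⟩, hC T hT g f hg⟩⟩
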